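/- Let $K$ be a field of characteristic $0$ (for instance $\mathbb{C}$), and let $G=(V,E)$ be a finite, connected, directed graph (loops and parallel edges are allowed) together with a drawing in the plane without crossings, in which vertices are distinct points and edges are polygonal arcs. Let $v_0\in V$, let $e_G=|E|$, and label every edge $e\in E$ by $\ell(e)=(x+a_e y)^2\in K[x,y]$ with $a_e\in K$. Let $\mathsf{Spl}_2(G,\ell;v_0)$ be the $K$-vector space of all families $p=(p(v))_{v\in V}$ of polynomials in $K[x,y]$, each zero or homogeneous of degree $2$, such that $p(v_0)=0$ and $p(u)-p(v)$ is a multiple of $\ell(e)$ for every edge $e$ from $u$ to $v$. Let $F_1,\dots,F_{f_G}$ be the bounded faces of the drawing, that is, the bounded connected components of its complement in the plane. The cycle basis matrix $M$ is the $f_G\times e_G$ matrix with entry $\varepsilon_{F,e}=1$ if $e$ lies on the boundary of $F$ and points clockwise around $F$ (that is, $F$ lies to the right of $e$ and not also to its left), $\varepsilon_{F,e}=-1$ if $e$ lies on the boundary of $F$ and points counterclockwise around $F$ ($F$ lies to the left of $e$ and not also to its right), and $\varepsilon_{F,e}=0$ otherwise. The extended cycle basis matrix $M^{\mathsf{ext}}$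 is the $3f_G\times e_G$ matrix over $K$ obtained from $M$ by replacing, for each bounded face $F$, the row $(\varepsilon_{F,e})_{e\in E}$ by the three rows $(\varepsilon_{F,e})_{e\in E}$, $(\varepsilon_{F,e}a_e)_{e\in E}$, $(\varepsilon_{F,e}a_e^2)_{e\in E}$. Then $$\dim_K \mathsf{Spl}_2(G,\ell;v_0)=e_G-\mathsf{rank}(M^{\mathsf{ext}}).$$ -/

import Mathlib

/-- A directed multigraph with vertex type `V` and edge type `E`; loops and parallel edges are
allowed. -/
structure DirGraph (V E : Type*) where
  /-- the tail of an edge -/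
  src : E → V
  /-- the head of an edge -/
  tgt : E → V

namespace DirGraph

variable {V E : Type*}

/-- The underlying undirected graph is connected: any two vertices are joined by a path that may
use edges in either direction. -/
def Connected (G : DirGraph V E) : Prop :=
  Nonempty V ∧ ∀ u v : V, Relation.EqvGen (fun u v => ∃ e, G.src e = u ∧ G.tgt e = v) u v

/-! ### Splines -/

/-- The `R`-module of splines on the edge-labelled graph `(G, ℓ)`: vertex labellings whose
difference along every edge is a multiple of the label of that edge. -/
def Spl {R : Type*} [CommRing R] (G : DirGraph V E) (ℓ : E → R) : Submodule R (V → R) where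
  carrier := {p | ∀ e, ℓ e ∣ p (G.src e) - p (G.tgt e)}
  add_mem' := by
    intro p q hp hq e
    have h := dvd_add (hp e) (hq e)
    have h' : (p + q) (G.src e) - (p + q) (G.tgt e)
        = (p (G.src e) - p (G.tgt e)) + (q (G.src e) - q (G.tgt e)) := by
      simp only [Pi.add_apply]; ring
    rw [h']; exact h
  zero_mem' := by intro e; simp
  smul_mem' := by
    intro c p hp e
    have h := (hp e).mul_left c
    simpa only [Pi.smul_apply, smul_eq_mul, mul_sub] using h

/-- `Spl_d(G, ℓ)`: the splines over `K[x, y]` all of whose vertex labels are zero or homogeneous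
of degree `d`, as a vector space over `K`. -/
noncomputable def SplDeg {K : Type*} [Field K] (G : DirGraph V E) (ℓ : E → MvPolynomial (Fin 2) K) (d : ℕ) :
    Submodule K (V → MvPolynomial (Fin 2) K) :=
  (G.Spl ℓ).restrictScalars K ⊓
    Submodule.pi Set.univ (fun _ => MvPolynomial.homogeneousSubmodule (Fin 2) K d)

/-- `Spl_d(G, ℓ; v₀)`: the splines in `Spl_d(G, ℓ)` that vanish at the vertex `v₀`. -/
noncomputable def SplDegAt {K : Type*} [Field K] (G : DirGraph V E) (ℓ : E → MvPolynomial (Fin 2) K) (d : ℕ)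
    (v₀ : V) : Submodule K (V → MvPolynomial (Fin 2) K) :=
  G.SplDeg ℓ d ⊓ LinearMap.ker (LinearMap.proj v₀)

/-- The homogeneous edge-labelling `e ↦ (x + a_e y)²`. -/
noncomputable def homLabel {K : Type*} [Field K] (a : E → K) : E → MvPolynomial (Fin 2) K :=
  fun e => (MvPolynomial.X 0 + MvPolynomial.C (a e) * MvPolynomial.X 1) ^ 2

/-! ### Plane drawings -/

/-- A drawing of `G` in the plane `ℂ` without crossings. Vertices are distinct points, and the
edge `e` is a polygonal arc (a polygon if `e` is a loop) from its tail to its head, given by its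
corners `corner e 0, …, corner e (len e)`. The pairs `(i, t)` with `i < len e`, `0 ≤ t < 1`,
`(i, t) ≠ (0, 0)` parametrize the interior of this arc. -/
structure PlaneDrawing (G : DirGraph V E) where
  /-- the point representing a vertex -/
  pos : V → ℂ
  /-- the number of segments of the arc of an edge -/
  len : E → ℕ
  /-- the corners of the arc of an edge; only the indices up to `len e` matter -/
  corner : E → ℕ → ℂ
  pos_injective : Function.Injective pos
  len_pos : ∀ e, 0 < len e
  corner_zero : ∀ e, corner e 0 = pos (G.src e)
  corner_len : ∀ e, corner e (len e) = pos (G.tgt e)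
  /-- the interiors of the arcs avoid the vertices -/
  interior_ne_pos : ∀ (e : E) (i : ℕ) (t : ℝ) (v : V),
    i < len e → t ∈ Set.Ico (0 : ℝ) 1 → 0 < (i : ℝ) + t →
      AffineMap.lineMap (corner e i) (corner e (i + 1)) t ≠ pos v
  /-- every arc is simple, and the interiors of different arcs are disjoint -/
  interior_injective : ∀ (e : E) (i : ℕ) (t : ℝ) (e' : E) (i' : ℕ) (t' : ℝ),
    i < len e → t ∈ Set.Ico (0 : ℝ) 1 → 0 < (i : ℝ) + t →
    i' < len e' → t' ∈ Set.Ico (0 : ℝ) 1 → 0 < (i' : ℝ) + t' →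
      AffineMap.lineMap (corner e i) (corner e (i + 1)) t =
        AffineMap.lineMap (corner e' i') (corner e' (i' + 1)) t' →
      e = e' ∧ i = i' ∧ t = t'

namespace PlaneDrawing

variable {G : DirGraph V E}

/-- The point with parameter `t` on the `i`-th segment of the arc of `e`. -/
noncomputable def point (D : G.PlaneDrawing) (e : E) (i : ℕ) (t : ℝ) : ℂ :=
  AffineMap.lineMap (D.corner e i) (D.corner e (i + 1)) t

/-- The subset of the plane covered by the drawing. -/
def support (D : G.PlaneDrawing) : Set ℂ :=
  Set.range D.pos ∪ ⋃ (e : E) (i : ℕ) (_ : i < D.len e),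
    segment ℝ (D.corner e i) (D.corner e (i + 1))

/-- `F` is a face: a connected component of the complement of the drawing. -/
def IsFace (D : G.PlaneDrawing) (F : Set ℂ) : Prop :=
  ∃ z ∈ (D.support)ᶜ, F = connectedComponentIn (D.support)ᶜ z

/-- The type of bounded faces. -/
def BoundedFace (D : G.PlaneDrawing) : Type :=
  {F : Set ℂ // D.IsFace F ∧ Bornology.IsBounded F}

/-- The set `F` lies immediately to the right of the edge `e`, travelled from tail to head:
from each point in the relative interior of each segment of the arc, a small step along the
right-hand normal leads into `F`. -/
def OnRight (D : G.PlaneDrawing) (F : Set ℂ) (e : E) : Prop :=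
  ∀ i < D.len e, ∀ t ∈ Set.Ioo (0 : ℝ) 1, ∀ᶠ δ : ℝ in nhdsWithin 0 (Set.Ioi 0),
    D.point e i t - (δ : ℂ) * (Complex.I * (D.corner e (i + 1) - D.corner e i)) ∈ F

/-- The set `F` lies immediately to the left of the edge `e`, travelled from tail to head. -/
def OnLeft (D : G.PlaneDrawing) (F : Set ℂ) (e : E) : Prop :=
  ∀ i < D.len e, ∀ t ∈ Set.Ioo (0 : ℝ) 1, ∀ᶠ δ : ℝ in nhdsWithin 0 (Set.Ioi 0),
    D.point e i t + (δ : ℂ) * (Complex.I * (D.corner e (i + 1) - D.corner e i)) ∈ F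

open Classical in
/-- The cycle basis matrix. An edge points clockwise around `F` if `F` lies to its right, and
counterclockwise if `F` lies to its left. An edge with `F` on both sides (a bridge running inside
`F`) is on no cycle, and its entry is `0`. -/
noncomputable def cycleBasisMatrix (D : G.PlaneDrawing) : Matrix D.BoundedFace E ℤ :=
  fun F e =>
    if D.OnRight F.1 e ∧ ¬ D.OnLeft F.1 e then 1
    else if D.OnLeft F.1 e ∧ ¬ D.OnRight F.1 e then -1
    else 0

/-- The extended cycle basis matrix: each row `(ε_e)_e` of the cycle basis matrix is replaced by
the three rows `(ε_e)_e`, `(ε_e a_e)_e`, `(ε_e a_e²)_e`. -/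
noncomputable def extCycleBasisMatrix {K : Type*} [Field K] (D : G.PlaneDrawing) (a : E → K) :
    Matrix (D.BoundedFace × Fin 3) E K :=
  fun r e => (D.cycleBasisMatrix r.1 e : K) * a e ^ (r.2 : ℕ)

end PlaneDrawing

end DirGraph

/-!
Edge by edge, a spline satisfies `p u - p v = c e * (x + a e * y) ^ d` for a scalar `c e`, and by
connectedness the vector `c` determines the spline. Comparing the coefficients of
`x ^ (d - j) * y ^ j`, a vector `c` comes from a spline iff every weighting `c e * a e ^ j` is the
difference of a vertex potential, that is, iff it is orthogonal to all integral cycles.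

It remains to see that the rows of the cycle basis matrix span the integral cycles. A row is the
jump, across each edge, of the indicator function of a face; around a node these jumps telescope,
so the row is a cycle. Conversely, a cycle is the jump of its own winding number, which is an
integer on each face and vanishes on the unbounded ones.
-/

/-! ### Chains and potentials -/

namespace DirGraph

variable {V E : Type*} (G : DirGraph V E)

theorem Connected.apply_eq_apply {G : DirGraph V E} (hG : G.Connected) {α : Sort*} {f : V → α}
    (hf : ∀ e, f (G.src e) = f (G.tgt e)) (u v : V) : f u = f v := by
  induction hG.2 u v with
  | rel u v h =>
    obtain ⟨e, rfl, rfl⟩ := h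
    exact hf e
  | refl u => rfl
  | symm u v _ ih => exact ih.symm
  | trans u v w _ _ ih₁ ih₂ => exact ih₁.trans ih₂

variable [Fintype E]

/-- The boundary map from integral `1`-chains to `0`-chains. The boundary of an edge is its tail
minus its head, matching the differences `p (src e) - p (tgt e)` in the definition of splines;
the cycles are the elements of the kernel. -/
noncomputable def boundary : (E → ℤ) →ₗ[ℤ] V →₀ ℤ :=
  Fintype.linearCombination ℤ fun e => Finsupp.single (G.src e) 1 - Finsupp.single (G.tgt e) 1

theorem boundary_apply (y : E → ℤ) :
    G.boundary y = ∑ e, y e • (Finsupp.single (G.src e) 1 - Finsupp.single (G.tgt e) 1) :=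
  Fintype.linearCombination_apply ..

theorem boundary_single [DecidableEq E] (e : E) :
    G.boundary (Pi.single e 1) = Finsupp.single (G.src e) 1 - Finsupp.single (G.tgt e) 1 := by
  simp [boundary]

theorem linearCombination_boundary {A : Type*} [AddCommGroup A] (g : V → A) (y : E → ℤ) :
    Finsupp.linearCombination ℤ g (G.boundary y) = ∑ e, y e • (g (G.src e) - g (G.tgt e)) := by
  simp [boundary_apply]

variable {G}

theorem Connected.exists_boundary_eq (hG : G.Connected) (u v : V) :
    ∃ y, G.boundary y = Finsupp.single u 1 - Finsupp.single v 1 := by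
  classical
  induction hG.2 u v with
  | rel u v h =>
    obtain ⟨e, rfl, rfl⟩ := h
    exact ⟨Pi.single e 1, G.boundary_single e⟩
  | refl u => exact ⟨0, by simp⟩
  | symm u v _ ih =>
    obtain ⟨y, hy⟩ := ih
    exact ⟨-y, by rw [map_neg, hy, neg_sub]⟩
  | trans u v w _ _ ih₁ ih₂ =>
    obtain ⟨y₁, h₁⟩ := ih₁
    obtain ⟨y₂, h₂⟩ := ih₂
    exact ⟨y₁ + y₂, by rw [map_add, h₁, h₂, sub_add_sub_cancel]⟩

theorem Connected.exists_potential (hG : G.Connected) (v₀ : V) {A : Type*} [AddCommGroup A]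
    {w : E → A} (hw : ∀ y, G.boundary y = 0 → ∑ e, y e • w e = 0) :
    ∃ q : V → A, q v₀ = 0 ∧ ∀ e, q (G.src e) - q (G.tgt e) = w e := by
  classical
  choose γ hγ using fun u => hG.exists_boundary_eq u v₀
  let period : (E → ℤ) →ₗ[ℤ] A := Fintype.linearCombination ℤ w
  have period_eq_zero {y : E → ℤ} (hy : G.boundary y = 0) : period y = 0 := hw y hy
  refine ⟨fun u => period (γ u), period_eq_zero (by simp [hγ]), fun e => ?_⟩
  have hcycle : G.boundary (γ (G.src e) - γ (G.tgt e) - Pi.single e 1) = 0 := by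
    simp [hγ, boundary_single]
  simpa [period, sub_eq_zero] using period_eq_zero hcycle

end DirGraph

open Set Filter Topology

/-! ### Half planes, segments and circles -/

theorem isClosed_segment {M : Type*} [AddCommGroup M] [Module ℝ M] [TopologicalSpace M]
    [IsTopologicalAddGroup M] [ContinuousSMul ℝ M] [T2Space M] (a b : M) :
    IsClosed (segment ℝ a b) := by
  rw [segment_eq_image_lineMap]
  exact (isCompact_Icc.image AffineMap.lineMap_continuous).isClosed

/-- The open half plane to the left of the line from `a` to `b`. -/
def leftSide (a b : ℂ) : Set ℂ := {p | 0 < ((p - a) / (b - a)).im}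

theorem mem_leftSide {a b p : ℂ} : p ∈ leftSide a b ↔ 0 < ((p - a) / (b - a)).im := Iff.rfl

theorem mem_leftSide_swap {a b p : ℂ} (hab : a ≠ b) :
    p ∈ leftSide b a ↔ ((p - a) / (b - a)).im < 0 := by
  have hba : b - a ≠ 0 := sub_ne_zero.2 hab.symm
  have hswap : (p - b) / (a - b) = 1 - (p - a) / (b - a) := by
    rw [← neg_sub b a, div_neg, eq_sub_iff_add_eq]
    field_simp
    ring
  simp [mem_leftSide, hswap]

theorem convex_leftSide (a b : ℂ) : Convex ℝ (leftSide a b) := by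
  have haffine : leftSide a b =
      ((Complex.imLm.comp (LinearMap.mulLeft ℝ (b - a)⁻¹)).toAffineMap) ⁻¹'
        Ioi (a / (b - a)).im := by
    ext p
    simp [mem_leftSide, div_eq_inv_mul, mul_sub]
  rw [haffine]
  exact (convex_Ioi _).affine_preimage _

theorem lineMap_add_mul_sub_div {a b : ℂ} (hab : a ≠ b) (t δ : ℝ) :
    (AffineMap.lineMap a b t + δ * (Complex.I * (b - a)) - a) / (b - a) = t + δ * Complex.I := by
  have hba : b - a ≠ 0 := sub_ne_zero.2 hab.symm
  simp only [AffineMap.lineMap_apply, vsub_eq_sub, vadd_eq_add, Complex.real_smul]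
  field_simp
  ring

theorem notMem_leftSide_of_mem_openSegment {a b p : ℂ} (hab : a ≠ b)
    (hp : p ∈ openSegment ℝ a b) : p ∉ leftSide a b := by
  rw [openSegment_eq_image_lineMap] at hp
  obtain ⟨t, -, rfl⟩ := hp
  simpa [mem_leftSide] using (congrArg Complex.im (lineMap_add_mul_sub_div hab t 0)).le

theorem tendsto_normal_leftSide {a b m : ℂ} (hab : a ≠ b) (hm : m ∈ openSegment ℝ a b) :
    Tendsto (fun δ : ℝ => m + δ * (Complex.I * (b - a))) (𝓝[>] 0) (𝓝[leftSide a b] m) := by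
  refine tendsto_nhdsWithin_iff.2 ⟨?_, ?_⟩
  · have hcont : Continuous fun δ : ℝ => m + δ * (Complex.I * (b - a)) := by fun_prop
    exact (hcont.tendsto' 0 m (by simp)).mono_left nhdsWithin_le_nhds
  · rw [openSegment_eq_image_lineMap] at hm
    obtain ⟨t, -, rfl⟩ := hm
    filter_upwards [self_mem_nhdsWithin] with δ hδ
    simpa [mem_leftSide, lineMap_add_mul_sub_div hab] using hδ

theorem neBot_nhdsWithin_leftSide {a b m : ℂ} (hab : a ≠ b) (hm : m ∈ openSegment ℝ a b) :
    (𝓝[leftSide a b] m).NeBot :=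
  (tendsto_normal_leftSide hab hm).neBot

section circle

variable {z w : ℂ} {r θ : ℝ}

theorem circleMap_sub_div_eq (hθ : w - z = ‖w - z‖ * Complex.exp (θ * Complex.I)) (φ : ℝ) :
    (circleMap z r φ - z) / (w - z) =
      ((r / ‖w - z‖ : ℝ) : ℂ) * Complex.exp ((φ - θ : ℝ) * Complex.I) := by
  rw [circleMap_sub_center, circleMap_zero, Complex.ofReal_sub, sub_mul, Complex.exp_sub,
    Complex.ofReal_div, div_mul_div_comm, ← hθ]

theorem sub_eq_of_circleMap_mem_openSegment (hr : 0 < r)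
    (h : circleMap z r θ ∈ openSegment ℝ z w) :
    w - z = ‖w - z‖ * Complex.exp (θ * Complex.I) := by
  rw [openSegment_eq_image_lineMap] at h
  obtain ⟨t, ht, h⟩ := h
  have ht0 : (t : ℂ) ≠ 0 := by exact_mod_cast ht.1.ne'
  simp only [AffineMap.lineMap_apply, vsub_eq_sub, vadd_eq_add, Complex.real_smul, circleMap] at h
  have hw : w - z = (r / t : ℝ) * Complex.exp (θ * Complex.I) := by
    push_cast
    field_simp
    linear_combination h
  have hnorm : ‖w - z‖ = r / t := by
    rw [hw, norm_mul, Complex.norm_real, Complex.norm_exp_ofReal_mul_I, mul_one,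
      Real.norm_of_nonneg (div_pos hr ht.1).le]
  rwa [hnorm]

theorem im_circleMap_sub_div (hr : 0 < r) (h : circleMap z r θ ∈ openSegment ℝ z w) (φ : ℝ) :
    ((circleMap z r φ - z) / (w - z)).im = r / ‖w - z‖ * Real.sin (φ - θ) := by
  rw [circleMap_sub_div_eq (sub_eq_of_circleMap_mem_openSegment hr h), Complex.im_ofReal_mul,
    Complex.exp_ofReal_mul_I_im]

theorem tendsto_circleMap_leftSide (hzw : z ≠ w) (hr : 0 < r)
    (h : circleMap z r θ ∈ openSegment ℝ z w) :
    Tendsto (circleMap z r) (𝓝[>] θ) (𝓝[leftSide z w] circleMap z r θ) := by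
  have hpos : 0 < r / ‖w - z‖ := div_pos hr (norm_sub_pos_iff.2 hzw.symm)
  refine tendsto_nhdsWithin_iff.2 ⟨((continuous_circleMap z r).tendsto θ).mono_left
    nhdsWithin_le_nhds, ?_⟩
  filter_upwards [Ioo_mem_nhdsGT (lt_add_of_pos_right θ Real.pi_pos)] with φ hφ
  rw [mem_leftSide, im_circleMap_sub_div hr h]
  exact mul_pos hpos (Real.sin_pos_of_pos_of_lt_pi (sub_pos.2 hφ.1) (sub_lt_iff_lt_add'.2 hφ.2))

theorem tendsto_circleMap_leftSide_swap (hzw : z ≠ w) (hr : 0 < r)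
    (h : circleMap z r θ ∈ openSegment ℝ z w) :
    Tendsto (circleMap z r) (𝓝[<] θ) (𝓝[leftSide w z] circleMap z r θ) := by
  have hpos : 0 < r / ‖w - z‖ := div_pos hr (norm_sub_pos_iff.2 hzw.symm)
  refine tendsto_nhdsWithin_iff.2 ⟨((continuous_circleMap z r).tendsto θ).mono_left
    nhdsWithin_le_nhds, ?_⟩
  filter_upwards [Ioo_mem_nhdsLT (sub_lt_self θ Real.pi_pos)] with φ hφ
  rw [mem_leftSide_swap hzw, im_circleMap_sub_div hr h]
  exact mul_neg_of_pos_of_neg hpos (Real.sin_neg_of_neg_of_neg_pi_lt (sub_neg.2 hφ.2)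
    (neg_lt_sub_iff_lt_add'.2 (sub_lt_iff_lt_add.1 hφ.1)))

theorem arg_sub_eq_of_circleMap_mem_openSegment (hzw : z ≠ w) (hr : 0 < r)
    (hθ : θ ∈ Ioc (-Real.pi) Real.pi) (h : circleMap z r θ ∈ openSegment ℝ z w) :
    (w - z).arg = θ := by
  rw [sub_eq_of_circleMap_mem_openSegment hr h,
    Complex.arg_real_mul _ (norm_sub_pos_iff.2 hzw.symm), Complex.arg_exp_mul_I,
    toIocMod_eq_self, neg_add_eq_sub, two_mul, add_sub_cancel_right]
  exact hθ

theorem circleMap_arg_mem_openSegment (hr : 0 < r) (hrw : r < ‖w - z‖) :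
    circleMap z r (w - z).arg ∈ openSegment ℝ z w := by
  have hpos : 0 < ‖w - z‖ := hr.trans hrw
  rw [openSegment_eq_image_lineMap]
  refine ⟨r / ‖w - z‖, ⟨div_pos hr hpos, (div_lt_one hpos).2 hrw⟩, ?_⟩
  have hdir := Complex.norm_mul_exp_arg_mul_I (w - z)
  have hne : (‖w - z‖ : ℂ) ≠ 0 := by exact_mod_cast hpos.ne'
  rw [AffineMap.lineMap_apply, vsub_eq_sub, vadd_eq_add, Complex.real_smul, circleMap]
  nth_rw 2 [← hdir]
  push_cast
  field_simp
  ring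

end circle

/-! ### Arrangements of segments and their faces -/

/-- A plane straight-line graph: nondegenerate segments from `src s` to `tgt s` that meet only in a
finite set of nodes containing all their endpoints. -/
structure SegmentArrangement (S : Type*) extends DirGraph ℂ S where
  /-- the points at which segments may meet -/
  nodes : Set ℂ
  nodes_finite : nodes.Finite
  src_mem : ∀ s, src s ∈ nodes
  tgt_mem : ∀ s, tgt s ∈ nodes
  src_ne_tgt : ∀ s, src s ≠ tgt s
  notMem_nodes : ∀ s, ∀ p ∈ openSegment ℝ (src s) (tgt s), p ∉ nodes
  eq_of_mem_openSegment : ∀ s t, ∀ p ∈ openSegment ℝ (src s) (tgt s),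
    p ∈ openSegment ℝ (src t) (tgt t) → s = t

namespace SegmentArrangement

variable {S : Type*} (𝒜 : SegmentArrangement S)

/-- The subset of the plane covered by the arrangement. -/
def carrier : Set ℂ := 𝒜.nodes ∪ ⋃ s, segment ℝ (𝒜.src s) (𝒜.tgt s)

/-- The face containing the point `p`, that is, its component in the complement of the
arrangement; empty if `p` lies on the arrangement. -/
def faceAt (p : ℂ) : Set ℂ := connectedComponentIn 𝒜.carrierᶜ p

/-- A face of the arrangement: a connected component of the complement. -/
def IsFace (F : Set ℂ) : Prop := ∃ z ∈ 𝒜.carrierᶜ, F = 𝒜.faceAt z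

/-- The start of a dart. A dart is a segment with a direction of travel: `(s, true)` runs from
`src s` to `tgt s`, and `(s, false)` runs backwards. -/
def tail : S × Bool → ℂ
  | (s, true) => 𝒜.src s
  | (s, false) => 𝒜.tgt s

/-- The end of a dart. -/
def head : S × Bool → ℂ
  | (s, true) => 𝒜.tgt s
  | (s, false) => 𝒜.src s

/-- The same segment, travelled in the opposite direction. -/
def rev (d : S × Bool) : S × Bool := (d.1, !d.2)

variable {𝒜}

theorem tail_rev (d : S × Bool) : 𝒜.tail (rev d) = 𝒜.head d := by
  rcases d with ⟨s, _ | _⟩ <;> rfl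

theorem head_rev (d : S × Bool) : 𝒜.head (rev d) = 𝒜.tail d := by
  rcases d with ⟨s, _ | _⟩ <;> rfl

theorem tail_ne_head (d : S × Bool) : 𝒜.tail d ≠ 𝒜.head d := by
  rcases d with ⟨s, _ | _⟩
  exacts [(𝒜.src_ne_tgt s).symm, 𝒜.src_ne_tgt s]

theorem tail_mem_nodes (d : S × Bool) : 𝒜.tail d ∈ 𝒜.nodes := by
  rcases d with ⟨s, _ | _⟩
  exacts [𝒜.tgt_mem s, 𝒜.src_mem s]

theorem openSegment_dart (d : S × Bool) :
    openSegment ℝ (𝒜.tail d) (𝒜.head d) = openSegment ℝ (𝒜.src d.1) (𝒜.tgt d.1) := by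
  rcases d with ⟨s, _ | _⟩
  exacts [openSegment_symm .., rfl]

theorem segment_subset_carrier (s : S) : segment ℝ (𝒜.src s) (𝒜.tgt s) ⊆ 𝒜.carrier :=
  (subset_iUnion (fun s => segment ℝ (𝒜.src s) (𝒜.tgt s)) s).trans subset_union_right

theorem mem_nodes_or_mem_openSegment {s : S} {p : ℂ} (hp : p ∈ segment ℝ (𝒜.src s) (𝒜.tgt s)) :
    p ∈ 𝒜.nodes ∨ p ∈ openSegment ℝ (𝒜.src s) (𝒜.tgt s) := by
  rw [← insert_endpoints_openSegment] at hp
  rcases hp with rfl | rfl | hp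
  exacts [.inl (𝒜.src_mem s), .inl (𝒜.tgt_mem s), .inr hp]

theorem eq_of_mem_segment {s t : S} {p : ℂ} (hs : p ∈ openSegment ℝ (𝒜.src s) (𝒜.tgt s))
    (ht : p ∈ segment ℝ (𝒜.src t) (𝒜.tgt t)) : s = t :=
  𝒜.eq_of_mem_openSegment s t p hs
    ((mem_nodes_or_mem_openSegment ht).resolve_left (𝒜.notMem_nodes s p hs))

theorem dart_eq_of_mem_openSegment {d d' : S × Bool} {z p : ℂ} (hd : 𝒜.tail d = z)
    (hd' : 𝒜.tail d' = z) (hp : p ∈ openSegment ℝ z (𝒜.head d))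
    (hp' : p ∈ openSegment ℝ z (𝒜.head d')) : d = d' := by
  rw [← hd, openSegment_dart] at hp
  rw [← hd', openSegment_dart] at hp'
  obtain ⟨s, b⟩ := d
  obtain ⟨s', b'⟩ := d'
  obtain rfl : s = s' := 𝒜.eq_of_mem_openSegment _ _ p hp hp'
  have hne := 𝒜.src_ne_tgt s
  cases b <;> cases b' <;> simp_all [tail]

section faces

variable {F F' : Set ℂ}

theorem IsFace.eq_faceAt (hF : 𝒜.IsFace F) {p : ℂ} (hp : p ∈ F) :
    F = 𝒜.faceAt p := by
  obtain ⟨z, -, rfl⟩ := hF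
  exact connectedComponentIn_eq hp

theorem IsFace.eq_of_eventually (hF : 𝒜.IsFace F) (hF' : 𝒜.IsFace F') {l : Filter ℂ} [l.NeBot]
    (h : ∀ᶠ p in l, p ∈ F) (h' : ∀ᶠ p in l, p ∈ F') : F = F' := by
  obtain ⟨p, hp, hp'⟩ := (h.and h').exists
  rw [hF.eq_faceAt hp, hF'.eq_faceAt hp']

end faces

variable [Finite S]

theorem isClosed_carrier : IsClosed 𝒜.carrier :=
  𝒜.nodes_finite.isClosed.union (isClosed_iUnion_of_finite fun _ => isClosed_segment _ _)

theorem eventually_faceAt_eq {z : ℂ} (hz : z ∉ 𝒜.carrier) :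
    ∀ᶠ p in 𝓝 z, 𝒜.faceAt p = 𝒜.faceAt z := by
  filter_upwards [𝒜.isClosed_carrier.isOpen_compl.connectedComponentIn.mem_nhds
    (mem_connectedComponentIn hz)] with p hp using (connectedComponentIn_eq hp).symm

variable (𝒜) in
theorem eventually_nhds_mem_segment (z : ℂ) :
    ∀ᶠ p in 𝓝 z, ∀ s, p ∈ segment ℝ (𝒜.src s) (𝒜.tgt s) → z ∈ segment ℝ (𝒜.src s) (𝒜.tgt s) := by
  refine eventually_all.2 fun s => ?_
  by_cases hz : z ∈ segment ℝ (𝒜.src s) (𝒜.tgt s)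
  · exact Eventually.of_forall fun _ _ => hz
  · filter_upwards [(isClosed_segment _ _).isOpen_compl.mem_nhds hz] with p hp h
    exact absurd h hp

theorem eventually_mem_openSegment {s : S} {m : ℂ} (hm : m ∈ openSegment ℝ (𝒜.src s) (𝒜.tgt s)) :
    ∀ᶠ p in 𝓝 m, p ∈ 𝒜.carrier → p ∈ openSegment ℝ (𝒜.src s) (𝒜.tgt s) := by
  filter_upwards [𝒜.nodes_finite.isClosed.isOpen_compl.mem_nhds (𝒜.notMem_nodes s m hm),
    𝒜.eventually_nhds_mem_segment m] with p hnode hseg hp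
  obtain ⟨t, ht⟩ := mem_iUnion.1 (hp.resolve_left hnode)
  obtain rfl := eq_of_mem_segment hm (hseg t ht)
  exact (mem_nodes_or_mem_openSegment ht).resolve_left hnode

theorem exists_isFace_eventually_mem (d : S × Bool) {m : ℂ}
    (hm : m ∈ openSegment ℝ (𝒜.tail d) (𝒜.head d)) :
    ∃ F, 𝒜.IsFace F ∧
      ∀ᶠ m' in 𝓝 m, ∀ᶠ p in 𝓝[leftSide (𝒜.tail d) (𝒜.head d)] m', p ∈ F := by
  obtain ⟨κ, hκ, hball⟩ := Metric.eventually_nhds_iff_ball.1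
    (eventually_mem_openSegment (openSegment_dart d ▸ hm))
  set halfDisc := Metric.ball m κ ∩ leftSide (𝒜.tail d) (𝒜.head d)
  have hsub : halfDisc ⊆ 𝒜.carrierᶜ := fun p hp hpc =>
    notMem_leftSide_of_mem_openSegment (tail_ne_head d)
      (openSegment_dart d ▸ hball p hp.1 hpc) hp.2
  have hconn : IsPreconnected halfDisc :=
    ((convex_ball m κ).inter (convex_leftSide _ _)).isPreconnected
  have hnear : ∀ᶠ m' in 𝓝 m, halfDisc ∈ 𝓝[leftSide (𝒜.tail d) (𝒜.head d)] m' := by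
    filter_upwards [Metric.ball_mem_nhds m hκ] with m' hm'
    exact inter_mem (nhdsWithin_le_nhds (Metric.isOpen_ball.mem_nhds hm')) self_mem_nhdsWithin
  have := neBot_nhdsWithin_leftSide (tail_ne_head d) hm
  obtain ⟨p, hp⟩ := Filter.nonempty_of_mem hnear.self_of_nhds
  exact ⟨_, ⟨p, hsub hp, rfl⟩,
    hnear.mono fun m' h => mem_of_superset h (hconn.subset_connectedComponentIn hp hsub)⟩

variable (𝒜) in
theorem exists_isFace_left (d : S × Bool) :
    ∃ F, 𝒜.IsFace F ∧ ∀ m ∈ openSegment ℝ (𝒜.tail d) (𝒜.head d),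
      ∀ᶠ p in 𝓝[leftSide (𝒜.tail d) (𝒜.head d)] m, p ∈ F := by
  choose! F hF hmem using fun m => exists_isFace_eventually_mem (𝒜 := 𝒜) d (m := m)
  have hconst : ∀ m ∈ openSegment ℝ (𝒜.tail d) (𝒜.head d),
      ∀ m' ∈ openSegment ℝ (𝒜.tail d) (𝒜.head d), F m = F m' := by
    intro m hm m' hm'
    refine (convex_openSegment _ _).isPreconnected.induction₂ (fun m m' => F m = F m') ?_
      (fun _ _ _ _ _ _ => Eq.trans) (fun _ _ _ _ => Eq.symm) hm hm'
    intro m hm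
    filter_upwards [nhdsWithin_le_nhds (hmem m hm), self_mem_nhdsWithin] with m' hmm' hm'
    have := neBot_nhdsWithin_leftSide (tail_ne_head d) hm'
    exact (hF m hm).eq_of_eventually (hF m' hm') hmm' (hmem m' hm').self_of_nhds
  have hmid := midpoint_mem_openSegment (𝕜 := ℝ) (𝒜.tail d) (𝒜.head d)
  exact ⟨_, hF _ hmid, fun m hm => hconst m hm _ hmid ▸ (hmem m hm).self_of_nhds⟩

variable (𝒜) in
/-- The face immediately to the left of a dart. -/
noncomputable def left (d : S × Bool) : Set ℂ := (𝒜.exists_isFace_left d).choose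

theorem isFace_left (d : S × Bool) : 𝒜.IsFace (𝒜.left d) :=
  (𝒜.exists_isFace_left d).choose_spec.1

theorem eventually_mem_left (d : S × Bool) {m : ℂ}
    (hm : m ∈ openSegment ℝ (𝒜.tail d) (𝒜.head d)) :
    ∀ᶠ p in 𝓝[leftSide (𝒜.tail d) (𝒜.head d)] m, p ∈ 𝒜.left d :=
  (𝒜.exists_isFace_left d).choose_spec.2 m hm

theorem eventually_mem_left_rev (d : S × Bool) {m : ℂ}
    (hm : m ∈ openSegment ℝ (𝒜.tail d) (𝒜.head d)) :
    ∀ᶠ p in 𝓝[leftSide (𝒜.head d) (𝒜.tail d)] m, p ∈ 𝒜.left (rev d) := by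
  have := eventually_mem_left (𝒜 := 𝒜) (rev d) (m := m)
  rw [tail_rev, head_rev] at this
  exact this (by rwa [openSegment_symm])

theorem left_eq_iff (d : S × Bool) {F : Set ℂ} (hF : 𝒜.IsFace F) :
    𝒜.left d = F ↔ ∀ m ∈ openSegment ℝ (𝒜.tail d) (𝒜.head d), ∀ᶠ δ : ℝ in 𝓝[>] 0,
      m + δ * (Complex.I * (𝒜.head d - 𝒜.tail d)) ∈ F := by
  have hleft {m : ℂ} (hm : m ∈ openSegment ℝ (𝒜.tail d) (𝒜.head d)) :=
    (tendsto_normal_leftSide (tail_ne_head d) hm).eventually (eventually_mem_left d hm)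
  refine ⟨fun h m hm => h ▸ hleft hm, fun h => ?_⟩
  have hmid := midpoint_mem_openSegment (𝕜 := ℝ) (𝒜.tail d) (𝒜.head d)
  obtain ⟨δ, hδ, hδ'⟩ := ((hleft hmid).and (h _ hmid)).exists
  rw [(isFace_left d).eq_faceAt hδ, hF.eq_faceAt hδ']

end SegmentArrangement

/-! ### Step functions and the faces around a node -/

section StepFunction

theorem eventually_nhdsLT_lt_iff (s : Finset ℝ) (x : ℝ) :
    ∀ᶠ y in 𝓝[<] x, ∀ t ∈ s, t < y ↔ t < x := by
  refine (eventually_all_finset s).2 fun t _ => ?_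
  rcases lt_or_ge t x with h | h
  · filter_upwards [nhdsWithin_le_nhds (lt_mem_nhds h)] with y hy using iff_of_true hy h
  · filter_upwards [self_mem_nhdsWithin] with y hy
    exact iff_of_false ((le_of_lt hy).trans h).not_gt h.not_gt

theorem eventually_nhdsGT_lt_iff (s : Finset ℝ) (x : ℝ) :
    ∀ᶠ y in 𝓝[>] x, ∀ t ∈ s, t < y ↔ t ≤ x := by
  refine (eventually_all_finset s).2 fun t _ => ?_
  rcases le_or_gt t x with h | h
  · filter_upwards [self_mem_nhdsWithin] with y hy using iff_of_true (h.trans_lt hy) h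
  · filter_upwards [nhdsWithin_le_nhds (gt_mem_nhds h)] with y hy
    exact iff_of_false hy.not_gt h.not_ge

variable {M : Type*} {f l r : ℝ → M}

theorem eventually_rightLimit_eq {U : Set ℝ} (hU : IsOpen U) {x : ℝ} {c : M}
    (hr : ∀ x, ∀ᶠ y in 𝓝[>] x, f y = r x) (hc : ∀ᶠ y in 𝓝[U] x, f y = c) :
    ∀ᶠ y in 𝓝[U] x, r y = c := by
  filter_upwards [eventually_eventually_nhdsWithin.2 hc, self_mem_nhdsWithin] with y hy hyU
  rw [hU.nhdsWithin_eq hyU] at hy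
  obtain ⟨t, ht, ht'⟩ := ((hr y).and (nhdsWithin_le_nhds hy)).exists
  exact ht.symm.trans ht'

theorem rightLimit_add_period {T : ℝ} (hf : Function.Periodic f T)
    (hr : ∀ x, ∀ᶠ y in 𝓝[>] x, f y = r x) (x : ℝ) : r (x + T) = r x := by
  have hshift : Tendsto (· + T) (𝓝[>] x) (𝓝[>] (x + T)) :=
    tendsto_nhdsWithin_iff.2 ⟨((continuous_add_const T).tendsto x).mono_left nhdsWithin_le_nhds,
      eventually_mem_nhdsWithin.mono fun _ => (add_lt_add_iff_right T).2⟩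
  obtain ⟨y, hy, hy'⟩ := ((hshift.eventually (hr (x + T))).and (hr x)).exists
  rw [← hy, ← hy', hf]

theorem rightLimit_eq_of_no_jumps {a b : ℝ} (hab : a ≤ b)
    (hl : ∀ x, ∀ᶠ y in 𝓝[<] x, f y = l x) (hr : ∀ x, ∀ᶠ y in 𝓝[>] x, f y = r x)
    (hlr : ∀ x ∈ Ioc a b, l x = r x) : r a = r b := by
  refine isPreconnected_Icc.induction₂ (s := Icc a b) (fun x y => r x = r y) ?_
    (fun _ _ _ _ _ _ => Eq.trans) (fun _ _ _ _ => Eq.symm) (left_mem_Icc.2 hab)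
    (right_mem_Icc.2 hab)
  intro x hx
  filter_upwards [nhdsWithin_le_nhds
      (eventually_nhdsWithin_iff.1 (eventually_rightLimit_eq isOpen_Iio hr (hl x))),
    nhdsWithin_le_nhds
      (eventually_nhdsWithin_iff.1 (eventually_rightLimit_eq isOpen_Ioi hr (hr x))),
    self_mem_nhdsWithin] with y hleft hright hy
  rcases lt_trichotomy y x with hyx | rfl | hyx
  · rw [hleft hyx, hlr x ⟨hy.1.trans_lt hyx, hx.2⟩]
  · rfl
  · rw [hright hyx]

theorem rightLimit_sub_eq_sum_jumps [AddCommGroup M] {s : Finset ℝ} {a b : ℝ} (hab : a ≤ b)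
    (hs : ∀ t ∈ s, t ∈ Ioc a b) (hl : ∀ x, ∀ᶠ y in 𝓝[<] x, f y = l x)
    (hr : ∀ x, ∀ᶠ y in 𝓝[>] x, f y = r x) (hlr : ∀ x ∈ Ioc a b, x ∉ s → l x = r x) :
    r b - r a = ∑ t ∈ s, (r t - l t) := by
  have hconst := rightLimit_eq_of_no_jumps (f := fun y => f y - ∑ t ∈ s with t < y, (r t - l t))
    (l := fun x => l x - ∑ t ∈ s with t < x, (r t - l t))
    (r := fun x => r x - ∑ t ∈ s with t ≤ x, (r t - l t)) hab
    (fun x => by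
      filter_upwards [hl x, eventually_nhdsLT_lt_iff s x] with y hy hpast
      rw [hy, Finset.filter_congr hpast])
    (fun x => by
      filter_upwards [hr x, eventually_nhdsGT_lt_iff s x] with y hy hpast
      rw [hy, Finset.filter_congr hpast])
    (fun x hx => by
      by_cases hxs : x ∈ s
      · have hsplit : s.filter (· ≤ x) = insert x (s.filter (· < x)) := by
          ext t
          simp only [Finset.mem_filter, Finset.mem_insert, le_iff_lt_or_eq]
          grind
        rw [hsplit, Finset.sum_insert (by simp)]
        abel
      · have hsame : s.filter (· ≤ x) = s.filter (· < x) :=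
          Finset.filter_congr fun t ht => (ne_of_mem_of_not_mem ht hxs).le_iff_lt
        rw [hsame, hlr x hx hxs])
  have hnone : s.filter (· ≤ a) = ∅ := Finset.filter_false_of_mem fun t ht => (hs t ht).1.not_ge
  have hall : s.filter (· ≤ b) = s := Finset.filter_true_of_mem fun t ht => (hs t ht).2
  rw [hnone, hall, Finset.sum_empty, sub_zero] at hconst
  rw [hconst, sub_sub_cancel]

end StepFunction

namespace SegmentArrangement

variable {S : Type*} {𝒜 : SegmentArrangement S}

theorem exists_dart_of_mem_segment {z : ℂ} (hz : z ∈ 𝒜.nodes) {s : S}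
    (hs : z ∈ segment ℝ (𝒜.src s) (𝒜.tgt s)) : ∃ d, d.1 = s ∧ 𝒜.tail d = z := by
  rw [← insert_endpoints_openSegment] at hs
  rcases hs with rfl | rfl | hs
  exacts [⟨(s, true), rfl, rfl⟩, ⟨(s, false), rfl, rfl⟩, absurd hz (𝒜.notMem_nodes s z hs)]

section Finite

variable [Finite S]

theorem eventually_exists_dart {z : ℂ} (hz : z ∈ 𝒜.nodes) :
    ∀ᶠ p in 𝓝[≠] z, p ∈ 𝒜.carrier →
      ∃ d, 𝒜.tail d = z ∧ p ∈ openSegment ℝ z (𝒜.head d) := by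
  have hnode : ∀ᶠ p in 𝓝[≠] z, p ∉ 𝒜.nodes := by
    filter_upwards [nhdsWithin_le_nhds
        ((𝒜.nodes_finite.subset sdiff_subset).isClosed.isOpen_compl.mem_nhds
          (fun h => h.2 rfl : z ∉ 𝒜.nodes \ {z})), self_mem_nhdsWithin] with p hp hpz hpn
    exact hp ⟨hpn, hpz⟩
  filter_upwards [hnode, nhdsWithin_le_nhds (𝒜.eventually_nhds_mem_segment z)] with p hpn hseg hp
  obtain ⟨s, hs⟩ := mem_iUnion.1 (hp.resolve_left hpn)
  obtain ⟨d, rfl, hd⟩ := exists_dart_of_mem_segment hz (hseg s hs)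
  exact ⟨d, hd, hd ▸ openSegment_dart d ▸ (mem_nodes_or_mem_openSegment hs).resolve_left hpn⟩

theorem exists_isolating_radius {z : ℂ} (hz : z ∈ 𝒜.nodes) :
    ∃ r > 0, (∀ d, 𝒜.tail d = z → r < ‖𝒜.head d - z‖) ∧
      ∀ θ, circleMap z r θ ∈ 𝒜.carrier →
        ∃ d, 𝒜.tail d = z ∧ circleMap z r θ ∈ openSegment ℝ z (𝒜.head d) := by
  obtain ⟨κ, hκ, hball⟩ := Metric.eventually_nhds_iff.1
    (eventually_nhdsWithin_iff.1 (eventually_exists_dart hz))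
  have hlong : ∀ᶠ r in 𝓝[>] (0 : ℝ), ∀ d, 𝒜.tail d = z → r < ‖𝒜.head d - z‖ := by
    refine eventually_all.2 fun d => ?_
    by_cases hd : 𝒜.tail d = z
    · have hpos : 0 < ‖𝒜.head d - z‖ := norm_sub_pos_iff.2 (hd ▸ (tail_ne_head d).symm)
      filter_upwards [nhdsWithin_le_nhds (gt_mem_nhds hpos)] with r hr _ using hr
    · exact Eventually.of_forall fun _ h => absurd h hd
  obtain ⟨r, hr, hr0, hrκ⟩ := (hlong.and (Ioo_mem_nhdsGT hκ)).exists
  refine ⟨r, hr0, hr, fun θ => hball ?_ (circleMap_ne_center hr0.ne')⟩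
  rwa [Metric.mem_sphere.1 (circleMap_mem_sphere z hr0.le θ)]

theorem eventually_faceAt_circleMap_eq_left {d : S × Bool} {z : ℂ} (hd : 𝒜.tail d = z) {r θ : ℝ}
    (hr : 0 < r) (h : circleMap z r θ ∈ openSegment ℝ z (𝒜.head d)) :
    ∀ᶠ φ in 𝓝[>] θ, 𝒜.faceAt (circleMap z r φ) = 𝒜.left d := by
  subst hd
  filter_upwards [(tendsto_circleMap_leftSide (tail_ne_head d) hr h).eventually
    (eventually_mem_left d h)] with φ hφ using ((isFace_left d).eq_faceAt hφ).symm

theorem eventually_faceAt_circleMap_eq_left_rev {d : S × Bool} {z : ℂ} (hd : 𝒜.tail d = z)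
    {r θ : ℝ} (hr : 0 < r) (h : circleMap z r θ ∈ openSegment ℝ z (𝒜.head d)) :
    ∀ᶠ φ in 𝓝[<] θ, 𝒜.faceAt (circleMap z r φ) = 𝒜.left (rev d) := by
  subst hd
  filter_upwards [(tendsto_circleMap_leftSide_swap (tail_ne_head d) hr h).eventually
    (eventually_mem_left_rev d h)] with φ hφ using ((isFace_left (rev d)).eq_faceAt hφ).symm

theorem exists_faces_beside_angle {z : ℂ} {r : ℝ} (hr : 0 < r)
    (hcircle : ∀ θ, circleMap z r θ ∈ 𝒜.carrier →
      ∃ d, 𝒜.tail d = z ∧ circleMap z r θ ∈ openSegment ℝ z (𝒜.head d)) (θ : ℝ) :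
    ∃ L R : Set ℂ, (∀ᶠ φ in 𝓝[<] θ, 𝒜.faceAt (circleMap z r φ) = L) ∧
      (∀ᶠ φ in 𝓝[>] θ, 𝒜.faceAt (circleMap z r φ) = R) ∧
      (circleMap z r θ ∉ 𝒜.carrier → L = R) ∧
      ∀ d, 𝒜.tail d = z → circleMap z r θ ∈ openSegment ℝ z (𝒜.head d) →
        L = 𝒜.left (rev d) ∧ R = 𝒜.left d := by
  by_cases hθ : circleMap z r θ ∈ 𝒜.carrier
  · obtain ⟨d, hd, hmem⟩ := hcircle θ hθ
    refine ⟨_, _, eventually_faceAt_circleMap_eq_left_rev hd hr hmem,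
      eventually_faceAt_circleMap_eq_left hd hr hmem, absurd hθ, fun d' hd' hmem' => ?_⟩
    rw [dart_eq_of_mem_openSegment hd hd' hmem hmem']
    exact ⟨rfl, rfl⟩
  · have hnear := (continuous_circleMap z r).tendsto θ |>.eventually (eventually_faceAt_eq hθ)
    refine ⟨_, _, nhdsWithin_le_nhds hnear, nhdsWithin_le_nhds hnear, fun _ => rfl,
      fun d hd hmem => absurd ?_ hθ⟩
    rw [← hd, openSegment_dart] at hmem
    exact segment_subset_carrier d.1 (openSegment_subset_segment _ _ _ (hd ▸ hmem))

variable (𝒜) in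
/-- The change of a function of the faces across each segment: its value on the right face minus
its value on the left face, when travelling from `src s` to `tgt s`. -/
noncomputable def jump (h : Set ℂ → ℤ) (s : S) : ℤ := h (𝒜.left (s, false)) - h (𝒜.left (s, true))

end Finite

variable [Fintype S]

theorem sum_left_sub_left_rev {M : Type*} [AddCommGroup M] (h : Set ℂ → M) {z : ℂ}
    (hz : z ∈ 𝒜.nodes) :
    ∑ d with 𝒜.tail d = z, (h (𝒜.left d) - h (𝒜.left (rev d))) = 0 := by
  classical
  obtain ⟨r, hr, hlong, hcircle⟩ := exists_isolating_radius hz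
  choose L R hL hR hLR hdart using exists_faces_beside_angle hr hcircle
  set darts : Finset (S × Bool) := {d | 𝒜.tail d = z}
  set angle : S × Bool → ℝ := fun d => (𝒜.head d - z).arg
  have htail {d : S × Bool} (hd : d ∈ darts) : 𝒜.tail d = z := (Finset.mem_filter.1 hd).2
  have hhit {d : S × Bool} (hd : d ∈ darts) :
      circleMap z r (angle d) ∈ openSegment ℝ z (𝒜.head d) :=
    circleMap_arg_mem_openSegment hr (hlong d (htail hd))
  have hinj : Set.InjOn angle darts := fun d hd d' hd' heq =>
    dart_eq_of_mem_openSegment (htail hd) (htail hd') (hhit hd) (heq ▸ hhit hd')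
  have hno_jump : ∀ θ ∈ Ioc (-Real.pi) Real.pi, θ ∉ darts.image angle → h (L θ) = h (R θ) := by
    refine fun θ hθ hθd => congrArg h (hLR θ fun hc => hθd ?_)
    obtain ⟨d, hd, hmem⟩ := hcircle θ hc
    exact Finset.mem_image.2 ⟨d, Finset.mem_filter.2 ⟨Finset.mem_univ d, hd⟩,
      arg_sub_eq_of_circleMap_mem_openSegment (hd ▸ tail_ne_head d) hr hθ hmem⟩
  have hturn : R Real.pi = R (-Real.pi) := by
    rw [← rightLimit_add_period (fun θ => congrArg 𝒜.faceAt (periodic_circleMap z r θ)) hR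
      (-Real.pi), neg_add_eq_sub, two_mul, add_sub_cancel_right]
  have hsum := rightLimit_sub_eq_sum_jumps (f := fun θ => h (𝒜.faceAt (circleMap z r θ)))
    (neg_le_self Real.pi_pos.le)
    (Finset.forall_mem_image.2 fun d _ => Complex.arg_mem_Ioc (𝒜.head d - z))
    (fun θ => (hL θ).mono fun _ => congrArg h) (fun θ => (hR θ).mono fun _ => congrArg h) hno_jump
  rw [hturn, sub_self, Finset.sum_image hinj] at hsum
  rw [hsum]
  refine Finset.sum_congr rfl fun d hd => ?_
  obtain ⟨hLd, hRd⟩ := hdart (angle d) d (htail hd) (hhit hd)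
  rw [hLd, hRd]

theorem boundary_jump (h : Set ℂ → ℤ) : 𝒜.boundary (𝒜.jump h) = 0 := by
  ext z
  have hdarts : 𝒜.boundary (𝒜.jump h) z =
      -∑ d with 𝒜.tail d = z, (h (𝒜.left d) - h (𝒜.left (rev d))) := by
    simp only [DirGraph.boundary_apply, Finsupp.finsetSum_apply, Finset.sum_filter,
      Fintype.sum_prod_type, Fintype.sum_bool, ← Finset.sum_neg_distrib]
    refine Finset.sum_congr rfl fun s _ => ?_
    by_cases hsrc : 𝒜.src s = z <;> by_cases htgt : 𝒜.tgt s = z <;>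
      simp [jump, tail, rev, hsrc, htgt]
  rw [hdarts, Finsupp.zero_apply, neg_eq_zero]
  by_cases hz : z ∈ 𝒜.nodes
  · exact sum_left_sub_left_rev h hz
  · refine Finset.sum_eq_zero fun d hd => absurd ?_ hz
    exact (Finset.mem_filter.1 hd).2 ▸ tail_mem_nodes d

open Classical in
theorem jump_eq_sum (h : Set ℂ → ℤ) :
    𝒜.jump h = ∑ F ∈ Finset.univ.image 𝒜.left, h F • 𝒜.jump (Pi.single F 1) := by
  funext s
  simp [jump, Pi.single_apply, mul_sub]

end SegmentArrangement

/-! ### Winding numbers -/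

theorem div_mem_slitPlane_of_notMem_segment {a b p : ℂ} (hp : p ∉ segment ℝ a b) :
    (a - p) / (b - p) ∈ Complex.slitPlane := by
  rw [mem_segment_iff_sameRay, Complex.sameRay_iff_arg_div_eq_zero, Complex.arg_eq_zero_iff,
    ← neg_sub a p, neg_div, Complex.neg_re, Complex.neg_im] at hp
  rw [Complex.mem_slitPlane_iff]
  grind

theorem continuousAt_log_div {a b p : ℂ} (hp : p ∉ segment ℝ a b) :
    ContinuousAt (fun p => Complex.log ((a - p) / (b - p))) p := by
  have hb : b - p ≠ 0 := fun h => hp (sub_eq_zero.1 h ▸ right_mem_segment ℝ a b)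
  exact ((continuousAt_const.sub continuousAt_id).div (continuousAt_const.sub continuousAt_id)
    hb).clog (div_mem_slitPlane_of_notMem_segment hp)

theorem tendsto_log_div_cobounded (a b : ℂ) :
    Tendsto (fun p => Complex.log ((a - p) / (b - p))) (Bornology.cobounded ℂ) (𝓝 0) := by
  have hinv : Tendsto (fun p : ℂ => 1 + (a - b) * (b - p)⁻¹) (Bornology.cobounded ℂ) (𝓝 1) := by
    simpa [Function.comp_def] using ((tendsto_inv₀_cobounded.comp
      (tendsto_const_sub_cobounded b)).const_mul (a - b)).const_add 1
  have hdiv : Tendsto (fun p : ℂ => (a - p) / (b - p)) (Bornology.cobounded ℂ) (𝓝 1) := by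
    refine hinv.congr' ?_
    filter_upwards [Bornology.isBounded_def.1 (Bornology.isBounded_singleton (x := b))] with p hp
    have : b - p ≠ 0 := fun h => hp (sub_eq_zero.1 h).symm
    field_simp
    ring
  simpa [Function.comp_def] using (continuousAt_clog (x := 1) (by simp)).tendsto.comp hdiv

theorem tendsto_div_midpoint {a b : ℂ} (hab : a ≠ b) :
    Tendsto (fun p => (a - p) / (b - p)) (𝓝 (midpoint ℝ a b)) (𝓝 (-1)) := by
  have hb : b - midpoint ℝ a b ≠ 0 := by
    rw [sub_ne_zero, Ne, eq_comm, midpoint_eq_right_iff]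
    exact hab
  have hvalue : (a - midpoint ℝ a b) / (b - midpoint ℝ a b) = -1 := by
    rw [div_eq_iff hb, midpoint_eq_smul_add, Complex.real_smul]
    push_cast [invOf_eq_inv]
    ring
  rw [← hvalue]
  exact (continuousAt_const.sub continuousAt_id).div (continuousAt_const.sub continuousAt_id) hb

theorem im_div_eq_neg_div {a b : ℂ} (hab : a ≠ b) (p : ℂ) :
    ((a - p) / (b - p)).im = -((p - a) / (b - a)).im / Complex.normSq ((p - b) / (b - a)) := by
  rcases eq_or_ne p b with rfl | hp
  · simp
  have hba : b - a ≠ 0 := sub_ne_zero.2 hab.symm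
  have hbp : b - p ≠ 0 := sub_ne_zero.2 hp.symm
  have hpb : p - b ≠ 0 := sub_ne_zero.2 hp
  have hratio : (a - p) / (b - p) = 1 + ((p - b) / (b - a))⁻¹ := by
    field_simp
    ring
  have hshift : (p - a) / (b - a) = 1 + (p - b) / (b - a) := by
    field_simp
    ring
  rw [hratio, hshift, Complex.add_im, Complex.add_im, Complex.inv_im, Complex.one_im, zero_add,
    zero_add]

theorem tendsto_log_div_leftSide {a b : ℂ} (hab : a ≠ b) :
    Tendsto (fun p => Complex.log ((a - p) / (b - p))) (𝓝[leftSide a b] (midpoint ℝ a b))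
      (𝓝 (-(Real.pi * Complex.I))) := by
  have hdiv : Tendsto (fun p => (a - p) / (b - p)) (𝓝[leftSide a b] (midpoint ℝ a b))
      (𝓝[{z | z.im < 0}] (-1)) := by
    refine tendsto_nhdsWithin_iff.2
      ⟨(tendsto_div_midpoint hab).mono_left nhdsWithin_le_nhds, ?_⟩
    filter_upwards [self_mem_nhdsWithin] with p hp
    have hpb : p ≠ b := by
      rintro rfl
      simp [mem_leftSide, sub_ne_zero.2 hab.symm] at hp
    rw [im_div_eq_neg_div hab]
    exact div_neg_of_neg_of_pos (neg_neg_of_pos hp) (Complex.normSq_pos.2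
      (div_ne_zero (sub_ne_zero.2 hpb) (sub_ne_zero.2 hab.symm)))
  simpa [Function.comp_def] using
    (Complex.tendsto_log_nhdsWithin_im_neg_of_re_neg_of_im_zero (z := -1) (by simp)
      (by simp)).comp hdiv

theorem tendsto_log_div_rightSide {a b : ℂ} (hab : a ≠ b) :
    Tendsto (fun p => Complex.log ((a - p) / (b - p))) (𝓝[leftSide b a] (midpoint ℝ a b))
      (𝓝 (Real.pi * Complex.I)) := by
  have hdiv : Tendsto (fun p => (a - p) / (b - p)) (𝓝[leftSide b a] (midpoint ℝ a b))
      (𝓝[{z | 0 ≤ z.im}] (-1)) := by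
    refine tendsto_nhdsWithin_iff.2
      ⟨(tendsto_div_midpoint hab).mono_left nhdsWithin_le_nhds, ?_⟩
    filter_upwards [self_mem_nhdsWithin] with p hp
    rw [mem_leftSide_swap hab] at hp
    rw [im_div_eq_neg_div hab]
    exact div_nonneg (neg_nonneg.2 hp.le) (Complex.normSq_nonneg _)
  simpa [Function.comp_def] using
    (Complex.tendsto_log_nhdsWithin_im_nonneg_of_re_neg_of_im_zero (z := -1) (by simp)
      (by simp)).comp hdiv

theorem exists_log_div_eq {u v : ℂ} (hu : u ≠ 0) (hv : v ≠ 0) :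
    ∃ n : ℤ, Complex.log (u / v) = Complex.log u - Complex.log v + n * (2 * Real.pi * Complex.I) :=
  Complex.exp_eq_exp_iff_exists_int.1 <| by
    rw [Complex.exp_sub, Complex.exp_log hu, Complex.exp_log hv,
      Complex.exp_log (div_ne_zero hu hv)]

namespace SegmentArrangement

variable {S : Type*} {𝒜 : SegmentArrangement S}

theorem IsFace.subset_compl {F : Set ℂ} (hF : 𝒜.IsFace F) : F ⊆ 𝒜.carrierᶜ := by
  obtain ⟨z, -, rfl⟩ := hF
  exact connectedComponentIn_subset _ _

variable [Fintype S]

variable (𝒜) in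
/-- The number of clockwise turns that the weighted family of segments `∑ s, y s • s` makes about
the point `p`. This is an integer if the family is a cycle and avoids `p`. -/
noncomputable def winding (y : S → ℤ) (p : ℂ) : ℂ :=
  ∑ s, y s * (Complex.log ((𝒜.src s - p) / (𝒜.tgt s - p)) / (2 * Real.pi * Complex.I))

variable {y : S → ℤ}

theorem exists_int_winding_eq (hy : 𝒜.boundary y = 0) {p : ℂ} (hp : p ∉ 𝒜.carrier) :
    ∃ n : ℤ, 𝒜.winding y p = n := by
  have hne {q : ℂ} (hq : q ∈ 𝒜.nodes) : q - p ≠ 0 :=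
    sub_ne_zero.2 fun h => hp (.inl (h ▸ hq))
  choose k hk using fun s => exists_log_div_eq (hne (𝒜.src_mem s)) (hne (𝒜.tgt_mem s))
  have hcycle : ∑ s, (y s : ℂ) * (Complex.log (𝒜.src s - p) - Complex.log (𝒜.tgt s - p)) = 0 := by
    have h := 𝒜.linearCombination_boundary (fun z => Complex.log (z - p)) y
    simpa [hy, zsmul_eq_mul, eq_comm] using h
  refine ⟨∑ s, y s * k s, ?_⟩
  push_cast
  rw [← sub_eq_zero, winding, ← Finset.sum_sub_distrib, ← zero_div (2 * Real.pi * Complex.I),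
    ← hcycle, Finset.sum_div]
  refine Finset.sum_congr rfl fun s _ => ?_
  rw [hk]
  field_simp
  ring

theorem continuousOn_winding : ContinuousOn (𝒜.winding y) 𝒜.carrierᶜ := by
  refine continuousOn_finsetSum _ fun s _ => continuousOn_const.mul ?_
  refine ContinuousOn.div_const (fun p hp => ContinuousAt.continuousWithinAt ?_) _
  exact continuousAt_log_div fun h => hp (segment_subset_carrier s h)

theorem IsFace.exists_winding_eq {F : Set ℂ} (hF : 𝒜.IsFace F) (hy : 𝒜.boundary y = 0) :
    ∃ n : ℤ, ∀ p ∈ F, 𝒜.winding y p = n := by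
  have hpre : IsPreconnected F := by
    obtain ⟨z, -, rfl⟩ := hF
    exact isPreconnected_connectedComponentIn
  obtain ⟨_, ⟨n, rfl⟩, hn⟩ := hpre.eqOn_const_of_mapsTo
    Complex.isClosedEmbedding_intCast.isInducing.isDiscrete_range
    (continuousOn_winding.mono hF.subset_compl)
    (fun p hp => (exists_int_winding_eq hy (hF.subset_compl hp)).imp fun _ h => h.symm)
    (range_nonempty _)
  exact ⟨n, hn⟩

theorem eq_zero_of_winding_eq {F : Set ℂ} (hF : ¬ Bornology.IsBounded F) {n : ℤ}
    (hn : ∀ p ∈ F, 𝒜.winding y p = n) : n = 0 := by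
  have hzero : Tendsto (𝒜.winding y) (Bornology.cobounded ℂ) (𝓝 0) := by
    have hsum := tendsto_finsetSum Finset.univ fun s _ =>
      ((tendsto_log_div_cobounded (𝒜.src s) (𝒜.tgt s)).div_const
        (2 * Real.pi * Complex.I)).const_mul (y s : ℂ)
    simp only [zero_div, mul_zero, Finset.sum_const_zero] at hsum
    exact hsum
  have hfreq : ∃ᶠ p in Bornology.cobounded ℂ, p ∈ F := fun h => hF (Bornology.isBounded_def.2 h)
  exact_mod_cast tendsto_nhds_unique_of_frequently_eq tendsto_const_nhds hzero
    (hfreq.mono fun p hp => (hn p hp).symm)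

theorem continuousAt_winding_sub {s : S} {m : ℂ} (hm : m ∈ openSegment ℝ (𝒜.src s) (𝒜.tgt s)) :
    ContinuousAt (fun p => 𝒜.winding y p -
      y s * (Complex.log ((𝒜.src s - p) / (𝒜.tgt s - p)) / (2 * Real.pi * Complex.I))) m := by
  classical
  simp only [winding, ← Finset.sum_erase_eq_sub (Finset.mem_univ s)]
  refine tendsto_finsetSum _ fun t ht => ?_
  have hmt : m ∉ segment ℝ (𝒜.src t) (𝒜.tgt t) := fun h =>
    Finset.ne_of_mem_erase ht (eq_of_mem_segment hm h).symm
  exact ((continuousAt_log_div hmt).div_const _).const_mul _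

theorem jump_eq_of_winding_eq {N : Set ℂ → ℤ}
    (hN : ∀ F, 𝒜.IsFace F → ∀ p ∈ F, 𝒜.winding y p = N F) : 𝒜.jump N = y := by
  funext s
  have hm := midpoint_mem_openSegment (𝕜 := ℝ) (𝒜.src s) (𝒜.tgt s)
  set m := midpoint ℝ (𝒜.src s) (𝒜.tgt s)
  have hab := 𝒜.src_ne_tgt s
  have hrest := (continuousAt_winding_sub (𝒜 := 𝒜) (y := y) hm).tendsto
  have hlimit {d : S × Bool} {H : Set ℂ} {c : ℂ} [(𝓝[H] m).NeBot]
      (hd : ∀ᶠ p in 𝓝[H] m, p ∈ 𝒜.left d)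
      (hc : Tendsto (fun p => Complex.log ((𝒜.src s - p) / (𝒜.tgt s - p))) (𝓝[H] m) (𝓝 c)) :=
    tendsto_nhds_unique (hrest.mono_left nhdsWithin_le_nhds)
      ((tendsto_const_nhds.congr' (hd.mono fun p hp => (hN _ (isFace_left d) p hp).symm)).sub
        ((hc.div_const (2 * Real.pi * Complex.I)).const_mul (y s : ℂ)))
  have := neBot_nhdsWithin_leftSide hab hm
  have := neBot_nhdsWithin_leftSide hab.symm (openSegment_symm ℝ (𝒜.src s) (𝒜.tgt s) ▸ hm)
  have hleft := hlimit (H := leftSide (𝒜.src s) (𝒜.tgt s)) (eventually_mem_left (s, true) hm)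
    (tendsto_log_div_leftSide hab)
  have hright := hlimit (d := (s, false)) (H := leftSide (𝒜.tgt s) (𝒜.src s))
    (eventually_mem_left_rev (s, true) hm) (tendsto_log_div_rightSide hab)
  have hhalf : Real.pi * Complex.I / (2 * Real.pi * Complex.I) = 1 / 2 := by
    field_simp [Complex.two_pi_I_ne_zero]
  rw [neg_div, hhalf] at hleft
  rw [hhalf] at hright
  rw [← Int.cast_inj (α := ℂ), jump, Int.cast_sub]
  exact sub_eq_iff_eq_add.2 (by linear_combination hleft - hright)

theorem exists_jump_eq (hy : 𝒜.boundary y = 0) :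
    ∃ N : Set ℂ → ℤ, (∀ F, 𝒜.IsFace F → ¬ Bornology.IsBounded F → N F = 0) ∧ 𝒜.jump N = y := by
  choose! N hN using fun F (hF : 𝒜.IsFace F) => hF.exists_winding_eq hy
  exact ⟨N, fun F hF hunbounded => eq_zero_of_winding_eq hunbounded (hN F hF),
    jump_eq_of_winding_eq hN⟩

end SegmentArrangement

/-! ### Plane drawings -/

namespace DirGraph.PlaneDrawing

variable {V E : Type*} {G : DirGraph V E} (D : G.PlaneDrawing)

theorem corner_ne_corner_succ {e : E} {i : ℕ} (hi : i < D.len e) :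
    D.corner e i ≠ D.corner e (i + 1) := by
  intro h
  have := D.interior_injective e i (1 / 3) e i (2 / 3) hi (by norm_num) (by positivity) hi
    (by norm_num) (by positivity) (by simp [← h])
  norm_num at this

theorem corner_eq_pos_or {e : E} {j : ℕ} (hj : j ≤ D.len e) :
    (∃ v, D.corner e j = D.pos v) ∨ (0 < j ∧ j < D.len e) := by
  rcases Nat.eq_zero_or_pos j with rfl | hpos
  · exact .inl ⟨_, D.corner_zero e⟩
  · rcases hj.eq_or_lt with rfl | hlt
    exacts [.inl ⟨_, D.corner_len e⟩, .inr ⟨hpos, hlt⟩]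

theorem point_ne_corner {e e' : E} {i j : ℕ} {t : ℝ} (hi : i < D.len e) (ht : t ∈ Ioo (0 : ℝ) 1)
    (hj : j ≤ D.len e') : D.point e i t ≠ D.corner e' j := by
  have hit : 0 < (i : ℝ) + t := add_pos_of_nonneg_of_pos i.cast_nonneg ht.1
  rcases D.corner_eq_pos_or hj with ⟨v, hv⟩ | ⟨hpos, hlt⟩
  · rw [hv]
    exact D.interior_ne_pos e i t v hi ⟨ht.1.le, ht.2⟩ hit
  · intro h
    have := D.interior_injective e i t e' j 0 hi ⟨ht.1.le, ht.2⟩ hit hlt (by norm_num)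
      (by simpa using hpos) (by simpa [point] using h)
    exact ht.1.ne' this.2.2

theorem eq_of_corner_eq {e e' : E} {j k : ℕ} (hpos : 0 < k) (hlt : k < D.len e)
    (hj : j ≤ D.len e') (h : D.corner e' j = D.corner e k) : e' = e ∧ j = k := by
  rcases D.corner_eq_pos_or hj with ⟨v, hv⟩ | ⟨hj0, hj1⟩
  · exact absurd (h.symm.trans hv) (by
      simpa using D.interior_ne_pos e k 0 v hlt (by norm_num) (by simpa using hpos))
  · have := D.interior_injective e' j 0 e k 0 hj1 (by norm_num) (by simpa using hj0) hlt
      (by norm_num) (by simpa using hpos) (by simpa using h)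
    exact ⟨this.1, this.2.1⟩

section Finite

variable [Finite V] [Finite E]

/-- The arrangement of all segments of a drawing; its nodes are the vertices and corners. -/
noncomputable def arrangement : SegmentArrangement (Σ e : E, Fin (D.len e)) where
  src s := D.corner s.1 s.2
  tgt s := D.corner s.1 (s.2 + 1)
  nodes := range D.pos ∪ (range (fun s : Σ e : E, Fin (D.len e) => D.corner s.1 s.2) ∪
    range (fun s : Σ e : E, Fin (D.len e) => D.corner s.1 (s.2 + 1)))
  nodes_finite := (finite_range _).union ((finite_range _).union (finite_range _))
  src_mem s := .inr (.inl ⟨s, rfl⟩)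
  tgt_mem s := .inr (.inr ⟨s, rfl⟩)
  src_ne_tgt s := D.corner_ne_corner_succ s.2.2
  notMem_nodes := by
    rintro ⟨e, i⟩ p hp
    rw [openSegment_eq_image_lineMap] at hp
    obtain ⟨t, ht, rfl⟩ := hp
    rintro (⟨v, hv⟩ | ⟨⟨e', j⟩, h⟩ | ⟨⟨e', j⟩, h⟩)
    · exact D.interior_ne_pos e i t v i.2 ⟨ht.1.le, ht.2⟩
        (add_pos_of_nonneg_of_pos (Nat.cast_nonneg _) ht.1) hv.symm
    · exact D.point_ne_corner i.2 ht j.2.le h.symm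
    · exact D.point_ne_corner i.2 ht j.2 h.symm
  eq_of_mem_openSegment := by
    rintro ⟨e, i⟩ ⟨e', i'⟩ p hp hp'
    rw [openSegment_eq_image_lineMap] at hp hp'
    obtain ⟨t, ht, rfl⟩ := hp
    obtain ⟨t', ht', h⟩ := hp'
    obtain ⟨rfl, hi, -⟩ := D.interior_injective e i t e' i' t' i.2 ⟨ht.1.le, ht.2⟩
      (add_pos_of_nonneg_of_pos (Nat.cast_nonneg _) ht.1) i'.2 ⟨ht'.1.le, ht'.2⟩
      (add_pos_of_nonneg_of_pos (Nat.cast_nonneg _) ht'.1) h.symm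
    rw [Fin.ext hi]

theorem carrier_arrangement : D.arrangement.carrier = D.support := by
  ext p
  simp only [SegmentArrangement.carrier, arrangement, support, mem_union, mem_iUnion, mem_range,
    Sigma.exists]
  constructor
  · rintro ((h | ⟨e, i, rfl⟩ | ⟨e, i, rfl⟩) | ⟨e, i, h⟩)
    · exact .inl h
    · exact .inr ⟨e, i, i.2, left_mem_segment ..⟩
    · exact .inr ⟨e, i, i.2, right_mem_segment ..⟩
    · exact .inr ⟨e, i, i.2, h⟩
  · rintro (h | ⟨e, i, hi, h⟩)
    exacts [.inl (.inl h), .inr ⟨e, ⟨i, hi⟩, h⟩]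

theorem isFace_arrangement_iff {F : Set ℂ} : D.arrangement.IsFace F ↔ D.IsFace F := by
  simp only [IsFace, SegmentArrangement.IsFace, SegmentArrangement.faceAt, carrier_arrangement]

theorem onLeft_iff {F : Set ℂ} (hF : D.IsFace F) {e : E} :
    D.OnLeft F e ↔ ∀ i, D.arrangement.left (⟨e, i⟩, true) = F := by
  simp only [SegmentArrangement.left_eq_iff _ (D.isFace_arrangement_iff.2 hF),
    openSegment_eq_image_lineMap, forall_mem_image, Fin.forall_iff]
  rfl

theorem onRight_iff {F : Set ℂ} (hF : D.IsFace F) {e : E} :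
    D.OnRight F e ↔ ∀ i, D.arrangement.left (⟨e, i⟩, false) = F := by
  have hneg (z w : ℂ) (δ : ℝ) : z + δ * (Complex.I * w) = z - δ * (Complex.I * -w) := by ring
  simp only [SegmentArrangement.left_eq_iff _ (D.isFace_arrangement_iff.2 hF), hneg, neg_sub,
    SegmentArrangement.openSegment_dart]
  simp only [openSegment_eq_image_lineMap, forall_mem_image, Fin.forall_iff]
  rfl

end Finite

variable [Finite V]

section cycles

variable [Fintype E]

theorem boundary_arrangement (y : E → ℤ) :
    D.arrangement.boundary (fun s => y s.1) = (G.boundary y).mapDomain D.pos := by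
  have htelescope (e : E) :
      ∑ i : Fin (D.len e), (Finsupp.single (D.corner e i) (1 : ℤ) -
          Finsupp.single (D.corner e (i + 1)) 1) =
        Finsupp.single (D.pos (G.src e)) 1 - Finsupp.single (D.pos (G.tgt e)) 1 := by
    rw [Fin.sum_univ_eq_sum_range (fun i => Finsupp.single (D.corner e i) (1 : ℤ) -
      Finsupp.single (D.corner e (i + 1)) 1), Finset.sum_range_sub', corner_zero, corner_len]
  rw [boundary_apply, boundary_apply, Fintype.sum_sigma, Finsupp.mapDomain_finsetSum]
  refine Finset.sum_congr rfl fun e _ => ?_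
  rw [Finsupp.mapDomain_smul, Finsupp.mapDomain_sub, Finsupp.mapDomain_single,
    Finsupp.mapDomain_single, ← htelescope, Finset.smul_sum]
  rfl

theorem boundary_arrangement_eq_zero_iff {y : E → ℤ} :
    D.arrangement.boundary (fun s => y s.1) = 0 ↔ G.boundary y = 0 := by
  rw [boundary_arrangement, ← Finsupp.mapDomain_zero (f := D.pos),
    (Finsupp.mapDomain_injective D.pos_injective).eq_iff]

variable {D} {y : (Σ e : E, Fin (D.len e)) → ℤ}

-- An interior corner of an arc is the end of exactly one segment and the start of the next one.
theorem apply_succ_eq_of_boundary_eq_zero (hy : D.arrangement.boundary y = 0) {e : E} {i : ℕ}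
    (hi : i + 1 < D.len e) : y ⟨e, i + 1, hi⟩ = y ⟨e, i, i.lt_succ_self.trans hi⟩ := by
  classical
  have hsrc (s : Σ e : E, Fin (D.len e)) :
      D.arrangement.src s = D.corner e (i + 1) ↔ ⟨e, i + 1, hi⟩ = s := by
    refine ⟨fun h => ?_, fun h => h ▸ rfl⟩
    obtain ⟨rfl, hs⟩ := D.eq_of_corner_eq i.succ_pos hi s.2.2.le h
    exact Sigma.ext rfl (heq_of_eq (Fin.ext hs.symm))
  have htgt (s : Σ e : E, Fin (D.len e)) :
      D.arrangement.tgt s = D.corner e (i + 1) ↔ ⟨e, i, i.lt_succ_self.trans hi⟩ = s := by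
    refine ⟨fun h => ?_, fun h => h ▸ rfl⟩
    obtain ⟨rfl, hs⟩ := D.eq_of_corner_eq i.succ_pos hi s.2.2 h
    exact Sigma.ext rfl (heq_of_eq (Fin.ext (Nat.succ_injective hs).symm))
  have := DFunLike.congr_fun hy (D.corner e (i + 1))
  simpa [boundary_apply, Finsupp.finsetSum_apply, Finsupp.single_apply, hsrc, htgt, mul_sub,
    sub_eq_zero] using this

theorem apply_eq_apply_of_boundary_eq_zero (hy : D.arrangement.boundary y = 0) {e : E}
    (i j : Fin (D.len e)) : y ⟨e, i⟩ = y ⟨e, j⟩ := by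
  have hzero (k : ℕ) (hk : k < D.len e) : y ⟨e, k, hk⟩ = y ⟨e, 0, D.len_pos e⟩ := by
    induction k with
    | zero => rfl
    | succ k ih => rw [apply_succ_eq_of_boundary_eq_zero hy hk, ih]
  rw [hzero i i.2, hzero j j.2]

end cycles

open Classical in
theorem cycleBasisMatrix_apply [Finite E] (F : D.BoundedFace) (e : E) (i : Fin (D.len e)) :
    D.cycleBasisMatrix F e = D.arrangement.jump (Pi.single F.1 1) ⟨e, i⟩ := by
  have := Fintype.ofFinite E
  have hconst (j : Fin (D.len e)) := apply_eq_apply_of_boundary_eq_zero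
    (D.arrangement.boundary_jump (Pi.single F.1 1)) j i
  rw [cycleBasisMatrix, D.onLeft_iff F.2.1, D.onRight_iff F.2.1]
  simp only [SegmentArrangement.jump, Pi.single_apply] at hconst ⊢
  grind

variable [Fintype E]

theorem boundary_cycleBasisMatrix (F : D.BoundedFace) :
    G.boundary (D.cycleBasisMatrix.row F) = 0 := by
  classical
  rw [← D.boundary_arrangement_eq_zero_iff]
  have hrow : (fun s : Σ e : E, Fin (D.len e) => D.cycleBasisMatrix.row F s.1) =
      D.arrangement.jump (Pi.single F.1 1) := funext fun s => D.cycleBasisMatrix_apply F s.1 s.2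
  rw [hrow, SegmentArrangement.boundary_jump]

theorem span_range_cycleBasisMatrix :
    Submodule.span ℤ (range D.cycleBasisMatrix.row) = LinearMap.ker G.boundary := by
  classical
  refine le_antisymm ?_ fun y hy => ?_
  · rw [Submodule.span_le, range_subset_iff]
    exact D.boundary_cycleBasisMatrix
  obtain ⟨N, hN, hjump⟩ := SegmentArrangement.exists_jump_eq
    (D.boundary_arrangement_eq_zero_iff.2 hy)
  have hy_eq : y = ∑ F ∈ Finset.univ.image D.arrangement.left,
      N F • fun e => D.arrangement.jump (Pi.single F 1) ⟨e, 0, D.len_pos e⟩ := by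
    funext e
    rw [← congrFun hjump ⟨e, 0, D.len_pos e⟩, SegmentArrangement.jump_eq_sum]
    simp
  rw [hy_eq]
  refine Submodule.sum_mem _ fun F hF => ?_
  obtain ⟨d, -, rfl⟩ := Finset.mem_image.1 hF
  by_cases hbounded : Bornology.IsBounded (D.arrangement.left d)
  · let F : D.BoundedFace := ⟨D.arrangement.left d,
      D.isFace_arrangement_iff.1 (SegmentArrangement.isFace_left d), hbounded⟩
    refine Submodule.smul_mem _ _ (Submodule.subset_span ⟨F, ?_⟩)
    funext e
    exact D.cycleBasisMatrix_apply F e _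
  · rw [hN _ (SegmentArrangement.isFace_left d) hbounded, zero_smul]
    exact Submodule.zero_mem _

theorem sum_cycleBasisMatrix_smul_eq_zero_iff (hG : G.Connected) (v₀ : V) {A : Type*}
    [AddCommGroup A] {w : E → A} :
    (∀ F, ∑ e, D.cycleBasisMatrix F e • w e = 0) ↔
      ∃ q : V → A, q v₀ = 0 ∧ ∀ e, q (G.src e) - q (G.tgt e) = w e := by
  constructor
  · intro hw
    refine hG.exists_potential v₀ fun y hy => ?_
    have hspan : Submodule.span ℤ (range D.cycleBasisMatrix.row) ≤
        LinearMap.ker (Fintype.linearCombination ℤ w) := by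
      rw [Submodule.span_le, range_subset_iff]
      exact hw
    rw [span_range_cycleBasisMatrix] at hspan
    exact hspan hy
  · rintro ⟨q, -, hq⟩ F
    simpa [hq, boundary_cycleBasisMatrix, eq_comm] using
      G.linearCombination_boundary q (D.cycleBasisMatrix.row F)

end DirGraph.PlaneDrawing

/-! ### Binary forms and splines -/

open MvPolynomial

theorem exists_eq_C_mul_of_dvd {σ R : Type*} [CommRing R] [IsDomain R] {f ℓ : MvPolynomial σ R}
    {d : ℕ} (hf : f.IsHomogeneous d) (hℓ : ℓ.IsHomogeneous d) (h : ℓ ∣ f) :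
    ∃ c, f = C c * ℓ := by
  obtain ⟨g, rfl⟩ := h
  by_cases hzero : ℓ * g = 0
  · exact ⟨0, by simp [hzero]⟩
  obtain ⟨hℓ0, hg0⟩ := mul_ne_zero_iff.1 hzero
  have hdeg := hf.totalDegree hzero
  rw [totalDegree_mul_of_isDomain hℓ0 hg0, hℓ.totalDegree hℓ0, Nat.add_eq_left,
    totalDegree_eq_zero_iff_eq_C] at hdeg
  exact ⟨_, by rw [mul_comm, ← hdeg]⟩

/-- The exponent of the monomial `x ^ (d - j) * y ^ j`. -/
noncomputable def binaryExponent (d : ℕ) (j : Fin (d + 1)) : Fin 2 →₀ ℕ :=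
  Finsupp.single 0 (d - j) + Finsupp.single 1 (j : ℕ)

theorem binaryExponent_injective (d : ℕ) : Function.Injective (binaryExponent d) := fun i j h =>
  Fin.ext (by simpa [binaryExponent] using DFunLike.congr_fun h 1)

section binaryForm

variable {R : Type*} [CommSemiring R]

/-- The binary form of degree `d` with normalized coefficients `q`, that is,
`∑ j, (d choose j) * q j * x ^ (d - j) * y ^ j`. The normalization makes the coefficients of
`(x + a * y) ^ d` the powers of `a`. -/
noncomputable def binaryForm (d : ℕ) : (Fin (d + 1) → R) →ₗ[R] MvPolynomial (Fin 2) R :=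
  Fintype.linearCombination R fun j => monomial (binaryExponent d j) (d.choose j : R)

variable {d : ℕ}

theorem coeff_binaryForm (q : Fin (d + 1) → R) (j : Fin (d + 1)) :
    coeff (binaryExponent d j) (binaryForm d q) = d.choose j * q j := by
  classical
  simp [binaryForm, Fintype.linearCombination_apply, coeff_sum, coeff_monomial,
    (binaryExponent_injective d).eq_iff, mul_comm]

theorem isHomogeneous_binaryForm (q : Fin (d + 1) → R) : (binaryForm d q).IsHomogeneous d := by
  rw [binaryForm, Fintype.linearCombination_apply]
  refine IsHomogeneous.sum _ _ _ fun j _ => ?_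
  rw [smul_monomial]
  refine isHomogeneous_monomial _ ?_
  rw [binaryExponent, map_add, Finsupp.degree_single, Finsupp.degree_single]
  exact Nat.sub_add_cancel j.is_le

theorem binaryForm_pow (a : R) :
    binaryForm d (fun j => a ^ (j : ℕ)) = (X 0 + C a * X 1) ^ d := by
  rw [add_comm (X 0), add_pow, Finset.sum_range, binaryForm, Fintype.linearCombination_apply]
  refine Finset.sum_congr rfl fun j _ => ?_
  rw [binaryExponent, smul_monomial, mul_pow, X_pow_eq_monomial, X_pow_eq_monomial, ← C_pow,
    C_mul_monomial, monomial_mul, ← map_natCast C, mul_comm, C_mul_monomial, add_comm]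
  simp [mul_comm]

end binaryForm

namespace DirGraph

variable {K : Type*} [Field K] {V E : Type*} {G : DirGraph V E} {d : ℕ} {a : E → K} {v₀ : V}

theorem mem_SplDegAt {ℓ : E → MvPolynomial (Fin 2) K} {p : V → MvPolynomial (Fin 2) K} :
    p ∈ G.SplDegAt ℓ d v₀ ↔
      (∀ e, ℓ e ∣ p (G.src e) - p (G.tgt e)) ∧ (∀ v, (p v).IsHomogeneous d) ∧ p v₀ = 0 := by
  simp only [SplDegAt, SplDeg, Submodule.mem_inf, Submodule.restrictScalars_mem, Submodule.mem_pi,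
    Set.mem_univ, true_imp_iff, mem_homogeneousSubmodule, LinearMap.mem_ker, LinearMap.proj_apply,
    and_assoc]
  rfl

variable (K G d) in
/-- The `x ^ d`-coefficients of the differences of a vertex labelling along the edges. -/
noncomputable def edgeCoeff : (V → MvPolynomial (Fin 2) K) →ₗ[K] (E → K) where
  toFun p e := coeff (binaryExponent d 0) (p (G.src e) - p (G.tgt e))
  map_add' p q := funext fun e => by simp only [Pi.add_apply, add_sub_add_comm, coeff_add]
  map_smul' c p := funext fun e => by
    simp only [Pi.smul_apply, ← smul_sub, coeff_smul, RingHom.id_apply]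

theorem edgeCoeff_apply (p : V → MvPolynomial (Fin 2) K) (e : E) :
    G.edgeCoeff K d p e = coeff (binaryExponent d 0) (p (G.src e) - p (G.tgt e)) := rfl

theorem sub_eq_binaryForm_of_mem_SplDegAt {p : V → MvPolynomial (Fin 2) K}
    (hp : p ∈ G.SplDegAt (fun e => (X 0 + C (a e) * X 1) ^ d) d v₀) (e : E) :
    p (G.src e) - p (G.tgt e) =
      binaryForm d fun j => G.edgeCoeff K d p e * a e ^ (j : ℕ) := by
  obtain ⟨hdvd, hhom, -⟩ := mem_SplDegAt.1 hp
  have hℓ := binaryForm_pow (d := d) (a e)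
  obtain ⟨c, hc⟩ := exists_eq_C_mul_of_dvd ((hhom _).sub (hhom _))
    (hℓ ▸ isHomogeneous_binaryForm _) (hdvd e)
  rw [← hℓ, ← smul_eq_C_mul, ← map_smul] at hc
  have hcoeff : G.edgeCoeff K d p e = c := by
    simp [edgeCoeff_apply, hc, coeff_binaryForm]
  rw [hc, hcoeff]
  rfl

theorem Connected.injective_edgeCoeff (hG : G.Connected) : Function.Injective
    ((G.edgeCoeff K d).domRestrict (G.SplDegAt (fun e => (X 0 + C (a e) * X 1) ^ d) d v₀)) := by
  refine (injective_iff_map_eq_zero _).2 fun p hp => Subtype.ext (funext fun v => ?_)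
  have hedge (e : E) : p.1 (G.src e) = p.1 (G.tgt e) := by
    have hzero : G.edgeCoeff K d p.1 e = 0 := congrFun hp e
    rw [← sub_eq_zero, sub_eq_binaryForm_of_mem_SplDegAt p.2, hzero]
    simp only [zero_mul]
    exact map_zero _
  rw [hG.apply_eq_apply hedge v v₀]
  exact (mem_SplDegAt.1 p.2).2.2

theorem mem_map_edgeCoeff_iff (hd : ∀ j : Fin (d + 1), (d.choose j : K) ≠ 0) {c : E → K} :
    c ∈ (G.SplDegAt (fun e => (X 0 + C (a e) * X 1) ^ d) d v₀).map (G.edgeCoeff K d) ↔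
      ∀ j : Fin (d + 1), ∃ q : V → K, q v₀ = 0 ∧
        ∀ e, q (G.src e) - q (G.tgt e) = c e * a e ^ (j : ℕ) := by
  constructor
  · rintro ⟨p, hp, rfl⟩ j
    refine ⟨fun v => coeff (binaryExponent d j) (p v) / d.choose j, ?_, fun e => ?_⟩
    · simp [(mem_SplDegAt.1 hp).2.2]
    · rw [← sub_div, ← coeff_sub, sub_eq_binaryForm_of_mem_SplDegAt hp, coeff_binaryForm,
        mul_div_cancel_left₀ _ (hd j)]
  · intro h
    choose q hq₀ hq using h
    have hdiff (e : E) :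
        binaryForm d (fun j => q j (G.src e)) - binaryForm d (fun j => q j (G.tgt e)) =
          binaryForm d (c e • fun j : Fin (d + 1) => a e ^ (j : ℕ)) := by
      rw [← map_sub]
      exact congrArg _ (funext fun j => hq j e)
    refine ⟨fun v => binaryForm d fun j => q j v, mem_SplDegAt.2 ⟨fun e => ?_,
      fun v => isHomogeneous_binaryForm _, ?_⟩, funext fun e => ?_⟩
    · rw [hdiff, map_smul, binaryForm_pow, smul_eq_C_mul]
      exact dvd_mul_left _ _
    · simp only [hq₀]
      exact map_zero _
    · simp [edgeCoeff_apply, hdiff, coeff_binaryForm]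

/-- The matrix whose rows are `(ε_e * a_e ^ j)_e` for `j ≤ d` and the rows `(ε_e)_e` of the cycle
basis matrix; `extCycleBasisMatrix` is the case `d = 2`. -/
noncomputable def PlaneDrawing.powCycleBasisMatrix (D : G.PlaneDrawing) (d : ℕ) (a : E → K) :
    Matrix (D.BoundedFace × Fin (d + 1)) E K :=
  fun r e => (D.cycleBasisMatrix r.1 e : K) * a e ^ (r.2 : ℕ)

variable [Fintype E]

theorem PlaneDrawing.mem_ker_powCycleBasisMatrix_iff (D : G.PlaneDrawing) {c : E → K} :
    c ∈ LinearMap.ker (D.powCycleBasisMatrix d a).mulVecLin ↔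
      ∀ (j : Fin (d + 1)) (F : D.BoundedFace),
        ∑ e, D.cycleBasisMatrix F e • (c e * a e ^ (j : ℕ)) = 0 := by
  rw [LinearMap.mem_ker, Matrix.mulVecLin_apply, funext_iff, Prod.forall, forall_comm]
  simp only [Matrix.mulVec, dotProduct, powCycleBasisMatrix, Pi.zero_apply, zsmul_eq_mul,
    mul_assoc, mul_comm (c _)]

theorem PlaneDrawing.map_edgeCoeff_eq_ker [Finite V] (D : G.PlaneDrawing) (hG : G.Connected)
    (hd : ∀ j : Fin (d + 1), (d.choose j : K) ≠ 0) :
    (G.SplDegAt (fun e => (X 0 + C (a e) * X 1) ^ d) d v₀).map (G.edgeCoeff K d) =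
      LinearMap.ker (D.powCycleBasisMatrix d a).mulVecLin := by
  ext c
  rw [mem_map_edgeCoeff_iff hd, D.mem_ker_powCycleBasisMatrix_iff]
  exact forall_congr' fun j => (D.sum_cycleBasisMatrix_smul_eq_zero_iff hG v₀).symm

end DirGraph

theorem mainTheorem2_general {K : Type*} [Field K] {V E : Type*} [Finite V] [Fintype E]
    (G : DirGraph V E) (hG : G.Connected) (D : G.PlaneDrawing) (a : E → K) (v₀ : V) (d : ℕ)
    (hd : ∀ j : Fin (d + 1), (d.choose j : K) ≠ 0) :
    (Module.finrank K (G.SplDegAt (fun e => (X 0 + C (a e) * X 1) ^ d) d v₀) : ℤ) =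
      (Fintype.card E : ℤ) - ((D.powCycleBasisMatrix d a).rank : ℤ) := by
  have hdim := LinearMap.finrank_range_of_inj
    (hG.injective_edgeCoeff (K := K) (d := d) (a := a) (v₀ := v₀))
  rw [LinearMap.range_domRestrict, D.map_edgeCoeff_eq_ker hG hd] at hdim
  have hrank := LinearMap.finrank_range_add_finrank_ker (D.powCycleBasisMatrix d a).mulVecLin
  rw [Module.finrank_fintype_fun_eq_card] at hrank
  rw [← hdim, ← hrank, Matrix.rank, Nat.cast_add, add_sub_cancel_left]

theorem mainTheorem2 {K : Type*} [Field K] [CharZero K] {V E : Type*} [Fintype V] [Fintype E]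
    (G : DirGraph V E) (hG : G.Connected) (D : G.PlaneDrawing) (a : E → K) (v₀ : V) :
    (Module.finrank K (G.SplDegAt (DirGraph.homLabel a) 2 v₀) : ℤ) =
      (Fintype.card E : ℤ) - ((D.extCycleBasisMatrix a).rank : ℤ) :=
  mainTheorem2_general G hG D a v₀ 2 fun j => Nat.cast_ne_zero.2 (Nat.choose_pos j.is_le).ne'
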